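/- Let $T$ be a complete first-order theory in a language $\mathcal{L}$, let $\kappa>|\mathcal{L}|+\aleph_0$, and let $\mathbb{M}\models T$ be a monster model: $\mathbb{M}$ is $\kappa$-saturated, and every elementary map between subsets of $\mathbb{M}$ of size $<\kappa$ extends to an automorphism of $\mathbb{M}$. Let $\varphi(x;y)$ be an $\mathcal{L}$-formula, where $x$ and $y$ are finite tuples of variables. All tuples below are taken in $\mathbb{M}$, and a set of formulas over $\mathbb{M}$ is called consistent if each of its finite subsets is satisfied by some tuple of $\mathbb{M}$. A family of formulas is $k$-inconsistent if any $k$ of its members, at distinct indices, are inconsistent. - $\varphi$ has $\mathrm{SOP}_1$ if there are tuples $(a_\eta)_{\eta\in 2^{<\omega}}$ such that $\{\varphi(x;a_{\eta|n}):n<\omega\}$ is consistent for every $\eta\in 2^{\omega}$, and $\{\varphi(x;a_\nu),\varphi(x;a_{\eta\frown\langle 1\rangle})\}$ is inconsistent whenever $\eta,\nu\in 2^{<\omega}$ and $\nu\trianglerighteq\eta\frown\langle 0\rangle$. - $\varphi$ has the *skew tree property* if there are indiscernible sequences $\langle a_i:i<\omega+\omega\rangle$ and $\langle b_i:i<\omega\rangle$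 such that $\{\varphi(x;a_i):i<\omega+\omega\}$ is consistent, $\{\varphi(x;b_i):i<\omega\}$ is inconsistent, $\langle b_i:i<\omega\rangle$ is indiscernible over $a_{<\omega}$, $\langle a_{\omega+i}:i<\omega\rangle$ is indiscernible over $a_{<\omega}b_{>0}$, and $b_0=a_\omega$. - $\varphi$ has the *tree property* if for some $k\geq 2$ there are tuples $(a_\eta)_{\eta\in\omega^{<\omega}}$ such that $\{\varphi(x;a_{\eta|n}):n<\omega\}$ is consistent for every $\eta\in\omega^{\omega}$, and $\{\varphi(x;a_{\eta\frown\langle i\rangle}):i<\omega\}$ is $k$-inconsistent for every $\eta\in\omega^{<\omega}$. Then: 1. If $\varphi$ has $\mathrm{SOP}_1$, then $\varphi$ has the skew tree property. 2. If $\varphi$ has the skew tree property, then $\varphi$ has the tree property. -/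

import Mathlib

open FirstOrder Cardinal

universe u v w

namespace SkewTree

section Monster

variable (L : FirstOrder.Language.{u, v}) (M : Type w) [L.Structure M]

/-- `M` is `κ`-saturated: over every parameter set `A ⊆ M` with `|A| < κ`, each set of formulas
in one variable that is finitely satisfiable in `M` is realized in `M`. -/
def IsSaturated (κ : Cardinal.{w}) : Prop :=
  ∀ A : Set M, #A < κ → ∀ p : Set (L[[A]].Formula (Fin 1)),
    (∀ q : Finset (L[[A]].Formula (Fin 1)), (q : Set (L[[A]].Formula (Fin 1))) ⊆ p →
      ∃ x : Fin 1 → M, ∀ ψ ∈ q, ψ.Realize x) →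
    ∃ x : Fin 1 → M, ∀ ψ ∈ p, ψ.Realize x

/-- `M` is (strongly) `κ`-homogeneous: each elementary map from a subset of size `< κ` to `M`
extends to an automorphism of `M`. -/
def IsHomogeneous (κ : Cardinal.{w}) : Prop :=
  ∀ A : Set M, #A < κ → ∀ f : A → M,
    (∀ ψ : L.Formula A, ψ.Realize (fun x : A => (x : M)) ↔ ψ.Realize f) →
    ∃ σ : M ≃[L] M, ∀ x : A, σ x = f x

end Monster

/-- `M` is a monster model of `T`: a `κ`-saturated, `κ`-homogeneous model of `T`, with
`κ > |L| + ℵ₀`. -/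
structure IsMonster {L : FirstOrder.Language.{u, v}} (T : L.Theory) (κ : Cardinal.{w})
    (M : Type w) [L.Structure M] : Prop where
  nonempty : Nonempty M
  models : M ⊨ T
  aleph0_lt : ℵ₀ < κ
  card_lt : Cardinal.lift.{w} L.card < Cardinal.lift.{max u v} κ
  saturated : IsSaturated L M κ
  homogeneous : IsHomogeneous L M κ

section Sequences

variable {M : Type w}

/-- The set of all coordinates of the tuples `a i`. -/
def coords {I β : Type*} (a : I → β → M) : Set M := {c | ∃ i j, a i j = c}

/-- The sequence of tuples `⟨a i : i ∈ I⟩` is `A`-indiscernible. -/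
def Indiscernible (L : FirstOrder.Language.{u, v}) [L.Structure M] (A : Set M)
    {I β : Type*} [LinearOrder I] (a : I → β → M) : Prop :=
  ∀ (n : ℕ) (ψ : L[[A]].Formula (Fin n × β)) (s t : Fin n → I), StrictMono s → StrictMono t →
    (ψ.Realize (fun p => a (s p.1) p.2) ↔ ψ.Realize (fun p => a (t p.1) p.2))

end Sequences

section Properties

variable {L : FirstOrder.Language.{u, v}} {M : Type w} [L.Structure M] {α β : Type*}

/-- The set of formulas `{φ(x; a i) : i ∈ I}` is consistent, i.e. finitely satisfiable in `M`. -/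
def Consistent (φ : L.Formula (α ⊕ β)) {I : Type*} (a : I → β → M) : Prop :=
  ∀ s : Finset I, ∃ x : α → M, ∀ i ∈ s, φ.Realize (Sum.elim x (a i))

/-- The family `{φ(x; a i) : i ∈ I}` is `k`-inconsistent: any `k` of its members, at distinct
indices, are inconsistent. -/
def KInconsistent (k : ℕ) (φ : L.Formula (α ⊕ β)) {I : Type*} (a : I → β → M) : Prop :=
  ∀ s : Finset I, s.card = k → ¬ ∃ x : α → M, ∀ i ∈ s, φ.Realize (Sum.elim x (a i))

/-- The initial segment of length `n` of an infinite sequence. -/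
def restrict {X : Type*} (η : ℕ → X) (n : ℕ) : List X := List.ofFn (fun i : Fin n => η i)

variable (M)

/-- `φ(x; y)` has SOP₁ in `M`. Nodes of `2^{<ω}` are lists of Booleans, with `false` for `0`,
`true` for `1`, and `l₁ <+: l₂` meaning that `l₁` is an initial segment of `l₂`. -/
def HasSOP1 (φ : L.Formula (α ⊕ β)) : Prop :=
  ∃ a : List Bool → β → M,
    (∀ η : ℕ → Bool, Consistent φ (fun n : ℕ => a (restrict η n))) ∧
    ∀ η ν : List Bool, (η ++ [false]) <+: ν →
      ¬ ∃ x : α → M, φ.Realize (Sum.elim x (a ν)) ∧ φ.Realize (Sum.elim x (a (η ++ [true])))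

/-- `φ(x; y)` has the skew tree property in `M`. The index set `ω + ω` is the lexicographic sum
`ℕ ⊕ₗ ℕ`: the element `a_i` is `a (Sum.inlₗ i)` and `a_{ω + i}` is `a (Sum.inrₗ i)`. -/
def HasSkewTreeProperty (φ : L.Formula (α ⊕ β)) : Prop :=
  ∃ (a : ℕ ⊕ₗ ℕ → β → M) (b : ℕ → β → M),
    Indiscernible L ∅ a ∧
    Indiscernible L ∅ b ∧
    Consistent φ a ∧
    ¬ Consistent φ b ∧
    Indiscernible L (coords (fun i : ℕ => a (Sum.inlₗ i))) b ∧
    Indiscernible L (coords (fun i : ℕ => a (Sum.inlₗ i)) ∪ coords (fun i : ℕ => b (i + 1)))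
      (fun i : ℕ => a (Sum.inrₗ i)) ∧
    b 0 = a (Sum.inrₗ 0)

/-- `φ(x; y)` has the tree property in `M`: for some `k ≥ 2` there are tuples indexed by
`ω^{<ω}` such that the formulas along each branch are consistent and those at the immediate
successors of any node are `k`-inconsistent. -/
def HasTreeProperty (φ : L.Formula (α ⊕ β)) : Prop :=
  ∃ k : ℕ, 2 ≤ k ∧ ∃ a : List ℕ → β → M,
    (∀ η : ℕ → ℕ, Consistent φ (fun n : ℕ => a (restrict η n))) ∧
    ∀ η : List ℕ, KInconsistent k φ (fun i : ℕ => a (η ++ [i]))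

end Properties

end SkewTree

/-!
From `SOP₁` to the skew tree property. In an `SOP₁` tree, the pigeonhole principle applied to the nodes
`ζ ⌢ 0ᵏ ⌢ 1` above a node `ζ` gives `k < l` such that the nodes for `k` and `l` satisfy the same formulas,
out of a given finite set, over the nodes chosen before. Repeating this above the node for `l` produces
pairs `(dᵢ, eᵢ)` with `{φ(x; dᵢ)}` consistent (the `dᵢ` lie on one branch), `{φ(x; eᵢ)}`
`2`-inconsistent (`eᵢ` leaves that branch in direction `1`) and `dᵢ`, `eᵢ` indistinguishable over the
earlier pairs (`exists_pairs_finset`). Compactness removes the restriction to finitely many formulas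
(`exists_pairs`), and Ramsey's theorem with compactness makes the sequence of pairs indiscernible and
indexed by `ω + ω* + ω` (`exists_indiscernible_pairs`). Let `a` consist of the `d` over the first and
third parts, and `b` of the first `d` of the third part followed by the `e` over the middle part in
reverse. As this `d` and the corresponding `e` have the same type over everything below, `b` looks over
`a_{<ω}` like a decreasing subsequence of `e`, hence is indiscernible.

Compactness is used in the form of `IsSaturated.exists_limit`: a family of countable tuples has a limit in
`M` along any ultrafilter. It is obtained by realizing one coordinate after the other, so that only
types over finite sets of parameters occur.

From the skew tree property to the tree property. Over `a_{<n}`, the elements `a_n` and `a_ω = b₀` are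
conjugate, and `b` is indiscernible and `k`-inconsistent. So for each `n` there are automorphisms fixing
`a_{<n}` that take `a_n` to the members of a `k`-inconsistent sequence. Composing these automorphisms
along the nodes of `ω^{<ω}` and applying them to `a_{<ω}` yields the tree (`hasTreeProperty_of_equivs`).
-/

namespace SkewTree

/-! ### Formulas and their variables -/

section Formulas

open FirstOrder.Language

variable {L : FirstOrder.Language.{u, v}} {M : Type w} [L.Structure M]

theorem realize_relabel_of_eq {V W : Type*} {χ : L.Formula V} {f : V → W} {x : V → M} {y : W → M}
    (h : ∀ i, y (f i) = x i) : (Formula.relabel f χ).Realize y ↔ χ.Realize x := by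
  rw [Formula.realize_relabel, show y ∘ f = x from funext h]

/-- Only finitely many coordinates of a tuple matter for the truth of a given formula. This is what
reduces tuples indexed by infinite sets to finite ones. -/
theorem exists_finset_support {V : Type*} (ψ : L.Formula V) :
    ∃ S : Finset V, ∀ x y : V → M, (∀ i ∈ S, x i = y i) → (ψ.Realize x ↔ ψ.Realize y) := by
  classical
  refine ⟨ψ.freeVarFinset, fun x y h => ?_⟩
  have hs : (ψ.freeVarFinset : Set V) ⊆ ψ.freeVarFinset := subset_rfl
  have hx := BoundedFormula.realize_restrictFreeVar' (M := M) (φ := ψ) hs (v := x)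
    (xs := default)
  have hy := BoundedFormula.realize_restrictFreeVar' (M := M) (φ := ψ) hs (v := y)
    (xs := default)
  have hxy : x ∘ ((↑) : ↥(ψ.freeVarFinset : Set V) → V) = y ∘ (↑) :=
    funext fun i => h i i.2
  rw [hxy] at hx
  exact hx.symm.trans hy

/-- A formula with constants from `A` is an `L`-formula with the parameter tuple `u` plugged in, for
any tuple `u` that enumerates at least `A`. -/
theorem exists_formula_params {V W : Type*} {A : Set M} (ψ : L[[A]].Formula W) (u : V → M)
    (hA : A ⊆ Set.range u) :
    ∃ χ : L.Formula (V ⊕ W), ∀ x : W → M, χ.Realize (Sum.elim u x) ↔ ψ.Realize x := by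
  choose p hp using fun c : A => hA c.2
  refine ⟨Formula.relabel (Sum.map p id) (BoundedFormula.constantsVarsEquiv ψ : L.Formula (A ⊕ W)),
    fun x => ?_⟩
  have h := BoundedFormula.realize_constantsVarsEquiv (M := M) (φ := ψ) (v := x) (xs := default)
  rw [Formula.realize_relabel]
  refine Iff.trans (iff_of_eq ?_) h
  unfold Formula.Realize
  congr 1
  funext i
  rcases i with c | i
  · exact hp c
  · rfl

/-- Conversely, plugging a tuple `u` of elements of `A` into an `L`-formula gives a formula with
constants from `A`. -/
theorem exists_formula_constants {V W : Type*} {A : Set M} (χ : L.Formula (V ⊕ W)) (u : V → M)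
    (hA : Set.range u ⊆ A) :
    ∃ ψ : L[[A]].Formula W, ∀ x : W → M, ψ.Realize x ↔ χ.Realize (Sum.elim u x) := by
  let p : V → A := fun i => ⟨u i, hA ⟨i, rfl⟩⟩
  refine ⟨BoundedFormula.constantsVarsEquiv.symm
    (Formula.relabel (Sum.map p id) χ : L.Formula (A ⊕ W)), fun x => ?_⟩
  have h := BoundedFormula.realize_constantsVarsEquiv (M := M)
    (φ := BoundedFormula.constantsVarsEquiv.symm (Formula.relabel (Sum.map p id) χ : L.Formula (A ⊕ W)))
    (v := x) (xs := default)
  rw [Equiv.apply_symm_apply] at h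
  refine h.symm.trans ?_
  refine (Formula.realize_relabel (φ := χ) (g := Sum.map p id)).trans (iff_of_eq ?_)
  congr 1
  funext i
  rcases i with c | i <;> rfl

/-- Consistency of finitely many instances of `φ(x; ·)`, whose parameters are coordinates of a
tuple `y`, is expressed by a single formula in `y`. -/
theorem exists_formula_consistent {α β : Type*} [Finite α] (φ : L.Formula (α ⊕ β)) {V I : Type*}
    [Finite I] (q : I → β → V) :
    ∃ χ : L.Formula V, ∀ y : V → M,
      χ.Realize y ↔ ∃ x : α → M, ∀ i, φ.Realize (Sum.elim x (y ∘ q i)) := by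
  refine ⟨Formula.iExs α (Formula.iInf fun i : I =>
    Formula.relabel (Sum.elim Sum.inr (Sum.inl ∘ q i)) φ), fun y => ?_⟩
  rw [Formula.realize_iExs]
  refine exists_congr fun x => ?_
  rw [Formula.realize_iInf]
  refine forall_congr' fun i => ?_
  rw [Formula.realize_relabel]
  refine iff_of_eq (congrArg _ ?_)
  funext j
  rcases j with j | j <;> rfl

end Formulas

section Indiscernibility
open FirstOrder.Language

variable {L : FirstOrder.Language.{u, v}} {M : Type w} [L.Structure M]

/-- To prove indiscernibility over `A` it suffices to treat `L`-formulas with a parameter tuple `p`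
enumerating at least `A`; the index type of `p` need not be `A` itself. -/
theorem Indiscernible.of_formula {V I β : Type*} [LinearOrder I] {A : Set M} {a : I → β → M}
    (p : V → M) (hA : A ⊆ Set.range p)
    (h : ∀ (n : ℕ) (χ : L.Formula (V ⊕ (Fin n × β))) (s t : Fin n → I), StrictMono s →
      StrictMono t → (χ.Realize (Sum.elim p fun q => a (s q.1) q.2) ↔
        χ.Realize (Sum.elim p fun q => a (t q.1) q.2))) :
    Indiscernible L A a := by
  intro n ψ s t hs ht
  obtain ⟨χ, hχ⟩ := exists_formula_params ψ p hA
  rw [← hχ, ← hχ]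
  exact h n χ s t hs ht

theorem Indiscernible.realize_iff {V I β : Type*} [LinearOrder I] {A : Set M} {a : I → β → M}
    (ha : Indiscernible L A a) (p : V → M) (hA : Set.range p ⊆ A) {n : ℕ}
    (χ : L.Formula (V ⊕ (Fin n × β))) {s t : Fin n → I} (hs : StrictMono s) (ht : StrictMono t) :
    χ.Realize (Sum.elim p fun q => a (s q.1) q.2) ↔
      χ.Realize (Sum.elim p fun q => a (t q.1) q.2) := by
  obtain ⟨ψ, hψ⟩ := exists_formula_constants χ p hA
  rw [← hψ, ← hψ]
  exact ha n ψ s t hs ht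

theorem Indiscernible.mono {I β : Type*} [LinearOrder I] {A B : Set M} {a : I → β → M}
    (ha : Indiscernible L B a) (hAB : A ⊆ B) : Indiscernible L A a :=
  .of_formula ((↑) : A → M) (by simp) fun _ χ _ _ hs ht =>
    ha.realize_iff _ (by simpa using hAB) χ hs ht

/-- Indiscernibility over `∅` for formulas whose variables are indexed by an arbitrary, possibly
infinite, linear order. -/
theorem Indiscernible.realize_iff_of_strictMono {I K β : Type*} [LinearOrder I] [LinearOrder K]
    {a : I → β → M} (ha : Indiscernible L ∅ a) (ψ : L.Formula (K × β)) {f g : K → I}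
    (hf : StrictMono f) (hg : StrictMono g) :
    ψ.Realize (fun q => a (f q.1) q.2) ↔ ψ.Realize (fun q => a (g q.1) q.2) := by
  classical
  rcases isEmpty_or_nonempty K with hK | ⟨⟨κ₀⟩⟩
  · exact iff_of_eq (congrArg _ (Subsingleton.elim _ _))
  obtain ⟨S, hS⟩ := exists_finset_support (M := M) ψ
  let F : Finset K := insert κ₀ (S.image Prod.fst)
  let e : Fin F.card ≃o F := F.orderIsoOfFin rfl
  let r : K → Fin F.card := fun κ => if h : κ ∈ F then e.symm ⟨κ, h⟩ else
    e.symm ⟨κ₀, Finset.mem_insert_self _ _⟩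
  have hr : ∀ κ ∈ F, (e (r κ) : K) = κ := fun κ h => by simp [r, h]
  have key : ∀ f : K → I, ψ.Realize (fun q => a (f q.1) q.2) ↔
      (Formula.relabel (fun q : K × β => (Sum.inr (r q.1, q.2) : Empty ⊕ (Fin F.card × β))) ψ).Realize
        (Sum.elim (Empty.elim : Empty → M) fun q => a (f (e q.1)) q.2) := by
    intro f
    rw [Formula.realize_relabel]
    refine hS _ _ fun q hq => ?_
    have : q.1 ∈ F := Finset.mem_insert_of_mem (Finset.mem_image_of_mem _ hq)
    simp [hr _ this]
  rw [key, key]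
  have he : StrictMono fun i => (e i : K) := fun i j hij => e.strictMono hij
  exact ha.realize_iff _ (by simp [Set.range_eq_empty]) _ (s := fun i => f (e i))
    (t := fun i => g (e i)) (hf.comp he) (hg.comp he)

end Indiscernibility

/-! ### Compactness and homogeneity in the monster model -/

/-- A sequence can be built by recursion, each entry standing in a given relation to the tuple of all
earlier ones. -/
theorem exists_seq_of_forall_exists {X : Type*} (R : ∀ i : ℕ, (Fin i → X) → X → Prop)
    (h : ∀ i g, ∃ x, R i g x) : ∃ f : ℕ → X, ∀ i, R i (fun j => f j) (f i) := by
  choose F hF using h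
  let f : ℕ → X := WellFounded.fix Nat.lt_wfRel.wf fun i rec => F i fun j => rec j j.2
  have hf : ∀ i, f i = F i fun j => f j := fun i => WellFounded.fix_eq _ _ _
  exact ⟨f, fun i => by rw [hf i]; exact hF _ _⟩

section Compactness
open FirstOrder.Language Filter

variable {L : FirstOrder.Language.{u, v}} {M : Type w} [L.Structure M] {κ : Cardinal.{w}}

theorem mk_range_lt (hκ : ℵ₀ < κ) {V : Type*} [Countable V] (g : V → M) :
    #(Set.range g) < κ :=
  (mk_le_aleph0_iff.2 (Set.countable_range g).to_subtype).trans_lt hκ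

/-- The step of the compactness argument: if `g` satisfies every formula that holds eventually of
the tuples `p i` without their last coordinate, then `g` can be prolonged by one element so that the
same is true of the whole tuples. -/
theorem IsSaturated.exists_realize_limit (hM : IsSaturated L M κ) (hκ : ℵ₀ < κ) {I V : Type*}
    [Countable V] (U : Filter I) [NeBot U] (p : I → V ⊕ Fin 1 → M) (g : V → M)
    (hg : ∀ ψ : L.Formula V, (∀ᶠ i in U, ψ.Realize (p i ∘ Sum.inl)) → ψ.Realize g) :
    ∃ x : Fin 1 → M, ∀ χ : L.Formula (V ⊕ Fin 1), (∀ᶠ i in U, χ.Realize (p i)) →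
      χ.Realize (Sum.elim g x) := by
  obtain ⟨x, hx⟩ := hM (Set.range g) (mk_range_lt hκ g)
    {ψ | ∃ χ : L.Formula (V ⊕ Fin 1), (∀ᶠ i in U, χ.Realize (p i)) ∧
      ∀ x, ψ.Realize x ↔ χ.Realize (Sum.elim g x)} (by
    intro q hq
    choose X hX hqX using fun ψ : q => hq ψ.2
    have h : (Formula.iExs (Fin 1) (Formula.iInf X)).Realize g := by
      refine hg _ ((eventually_all.2 hX).mono fun i hi => ?_)
      rw [Formula.realize_iExs]
      refine ⟨p i ∘ Sum.inr, ?_⟩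
      rw [Formula.realize_iInf, Sum.elim_comp_inl_inr]
      exact hi
    rw [Formula.realize_iExs] at h
    obtain ⟨x, hx⟩ := h
    rw [Formula.realize_iInf] at hx
    exact ⟨x, fun ψ hψ => (hqX ⟨ψ, hψ⟩ x).2 (hx ⟨ψ, hψ⟩)⟩)
  refine ⟨x, fun χ hχ => ?_⟩
  obtain ⟨ψ, hψ⟩ := exists_formula_constants χ g subset_rfl
  exact (hψ x).1 (hx ψ ⟨χ, hχ, hψ⟩)

theorem IsSaturated.exists_nat_limit (hM : IsSaturated L M κ) (hκ : ℵ₀ < κ) {I : Type*}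
    (U : Filter I) [NeBot U] (p : I → ℕ → M) :
    ∃ g : ℕ → M, ∀ ψ : L.Formula ℕ, (∀ᶠ i in U, ψ.Realize (p i)) → ψ.Realize g := by
  obtain ⟨g, hg⟩ := exists_seq_of_forall_exists
    (fun k (g : Fin k → M) x =>
      (∀ ψ : L.Formula (Fin k), (∀ᶠ i in U, ψ.Realize fun j => p i j) → ψ.Realize g) →
      ∀ ψ : L.Formula (Fin (k + 1)), (∀ᶠ i in U, ψ.Realize fun j => p i j) →
        ψ.Realize (Fin.snoc g x : Fin (k + 1) → M)) (by
    intro k g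
    by_cases hg : ∀ ψ : L.Formula (Fin k), (∀ᶠ i in U, ψ.Realize fun j => p i j) → ψ.Realize g
    · obtain ⟨x, hx⟩ := hM.exists_realize_limit hκ U
        (fun i => Sum.elim (fun j : Fin k => p i j) fun _ => p i k) g hg
      refine ⟨x 0, fun _ ψ hψ => ?_⟩
      have h := hx (ψ.relabel finSumFinEquiv.symm) (hψ.mono fun i hi => by
        rw [Formula.realize_relabel]
        refine (iff_of_eq (congrArg _ ?_)).1 hi
        funext j
        refine Fin.lastCases ?_ (fun j => ?_) j <;> simp)
      rw [Formula.realize_relabel] at h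
      refine (iff_of_eq (congrArg _ ?_)).1 h
      funext j
      refine Fin.lastCases ?_ (fun j => ?_) j <;> simp
    · exact ⟨p U.nonempty_of_neBot.some 0, fun h => absurd h hg⟩)
  have hk : ∀ k, ∀ ψ : L.Formula (Fin k), (∀ᶠ i in U, ψ.Realize fun j => p i j) →
      ψ.Realize fun j => g j := by
    intro k
    induction k with
    | zero =>
      intro ψ hψ
      obtain ⟨i, hi⟩ := hψ.exists
      exact (iff_of_eq (congrArg _ (Subsingleton.elim _ _))).1 hi
    | succ k ih =>
      intro ψ hψ
      refine (iff_of_eq (congrArg _ ?_)).1 (hg k ih ψ hψ)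
      funext j
      refine Fin.lastCases ?_ (fun j => ?_) j <;> simp
  refine ⟨g, fun ψ hψ => ?_⟩
  -- Truncating variables above the support leaves a formula in finitely many variables.
  obtain ⟨S, hS⟩ := exists_finset_support (M := M) ψ
  let r : ℕ → Fin (S.sup id + 1) := fun i => ⟨min i (S.sup id), by omega⟩
  have key : ∀ y : ℕ → M, (ψ.relabel r).Realize (fun j => y j) ↔ ψ.Realize y := by
    intro y
    rw [Formula.realize_relabel]
    refine hS _ _ fun i hi => ?_
    have : i ≤ S.sup id := Finset.le_sup (f := id) hi
    simp [r, this]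
  exact (key g).1 (hk _ _ (hψ.mono fun i hi => (key _).2 hi))

/-- Compactness: any family of countable tuples has a limit along an ultrafilter `U`, a tuple of
`M` satisfying exactly the formulas that hold `U`-almost everywhere. -/
theorem IsSaturated.exists_limit [Nonempty M] (hM : IsSaturated L M κ) (hκ : ℵ₀ < κ) {I V : Type*}
    [Countable V] (U : Ultrafilter I) (p : I → V → M) :
    ∃ g : V → M, ∀ ψ : L.Formula V, ψ.Realize g ↔ ∀ᶠ i in U, ψ.Realize (p i) := by
  obtain ⟨f, hf⟩ := exists_injective_nat V
  obtain ⟨g, hg⟩ := hM.exists_nat_limit hκ (U : Filter I)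
    (fun i => Function.extend f (p i) fun _ => Classical.arbitrary M)
  have h : ∀ ψ : L.Formula V, (∀ᶠ i in U, ψ.Realize (p i)) → ψ.Realize (g ∘ f) := by
    intro ψ hψ
    have := hg (ψ.relabel f) (hψ.mono fun i hi => by
      rwa [Formula.realize_relabel, Function.extend_comp hf])
    rwa [Formula.realize_relabel] at this
  refine ⟨g ∘ f, fun ψ => ⟨fun hψ => ?_, h ψ⟩⟩
  by_contra hn
  have := h ψ.not ((Ultrafilter.eventually_not.2 hn).mono fun i hi => Formula.realize_not.2 hi)
  exact Formula.realize_not.1 this hψ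

/-- Two countable tuples with the same type are conjugate under an automorphism. -/
theorem IsHomogeneous.exists_equiv (hM : IsHomogeneous L M κ) (hκ : ℵ₀ < κ) {V : Type*}
    [Countable V] (x y : V → M) (h : ∀ ψ : L.Formula V, ψ.Realize x ↔ ψ.Realize y) :
    ∃ σ : M ≃[L] M, ∀ i, σ (x i) = y i := by
  choose p hp using fun c : Set.range x => c.2
  obtain ⟨σ, hσ⟩ := hM (Set.range x) (mk_range_lt hκ x) (y ∘ p) (fun ψ => by
    have := h (ψ.relabel p)
    rw [Formula.realize_relabel, Formula.realize_relabel] at this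
    rw [← this]
    exact iff_of_eq (congrArg _ (funext fun c => (hp c).symm)))
  refine ⟨σ, fun i => ?_⟩
  rw [hσ ⟨x i, i, rfl⟩]
  have := h ((Term.var (p ⟨x i, i, rfl⟩)).equal (Term.var i))
  rw [Formula.realize_equal, Formula.realize_equal] at this
  exact this.1 (hp ⟨x i, i, rfl⟩)

end Compactness

/-! ### Ramsey's theorem -/

section Ramsey
open Filter

/-- Whether `l` belongs to `P` after `j` further entries have been appended, each of them generic for
the ultrafilter `U`; the quantifiers over the new entries are nested, the first entry outermost. -/
def predict (U : Ultrafilter ℕ) (P : List ℕ → Prop) : ℕ → List ℕ → Prop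
  | 0, l => P l
  | j + 1, l => ∀ᶠ i in U, predict U P j (l ++ [i])

/-- The infinite Ramsey theorem for colourings of increasing `k`-tuples with two colours. -/
theorem exists_homogeneous_subseq (k : ℕ) (P : (Fin k → ℕ) → Prop) :
    ∃ g : ℕ → ℕ, StrictMono g ∧
      ∀ s t : Fin k → ℕ, StrictMono s → StrictMono t → (P (g ∘ s) ↔ P (g ∘ t)) := by
  let Q : List ℕ → Prop := fun l => P fun i => l.getD i 0
  let U : Ultrafilter ℕ := hyperfilter ℕ
  have hU : ∀ N, ∀ᶠ i in U, N < i := fun N =>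
    (Filter.hyperfilter_le_cofinite (α := ℕ)) (by
      rw [Nat.cofinite_eq_atTop]; exact eventually_gt_atTop N)
  -- Each new value is chosen so that appending it to an earlier list has the predicted effect.
  obtain ⟨g, hg⟩ := exists_seq_of_forall_exists
    (fun m (g : Fin m → ℕ) x => (∀ i, g i < x) ∧
      ∀ l ∈ {l : List (Fin m) | l.length ≤ k}, ∀ j : Fin k,
        (predict U Q j (l.map g ++ [x]) ↔ predict U Q (j + 1) (l.map g))) (by
    intro m g
    refine Eventually.exists (f := (U : Filter ℕ)) ?_
    refine (eventually_all.2 fun i => hU _).and ?_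
    refine (eventually_all_finite (List.finite_length_le _ _)).2 fun l _ => ?_
    refine eventually_all.2 fun j => ?_
    by_cases h : predict U Q (j + 1) (l.map g)
    · have h' : ∀ᶠ i in U, predict U Q j (l.map g ++ [i]) := h
      exact h'.mono fun i hi => iff_of_true hi h
    · have h' : ¬ ∀ᶠ i in U, predict U Q j (l.map g ++ [i]) := h
      exact (Ultrafilter.eventually_not.2 h').mono fun i hi => iff_of_false hi h)
  have hmono : StrictMono g := fun i j hij => (hg j).1 ⟨i, hij⟩
  have key : ∀ (l : List ℕ) (j : ℕ), l.Pairwise (· < ·) → l.length + j = k →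
      (predict U Q j (l.map g) ↔ predict U Q k []) := by
    intro l
    induction l using List.reverseRecOn with
    | nil =>
      intro j _ hj
      obtain rfl : j = k := by simpa using hj
      rfl
    | append_singleton l m ih =>
      intro j hl hj
      rw [List.pairwise_append] at hl
      rw [List.length_append, List.length_singleton] at hj
      have hlm : ∀ x ∈ l, x < m := fun x hx => hl.2.2 x hx m (by simp)
      rw [← ih (j + 1) hl.1 (by omega)]
      have h := (hg m).2 (l.pmap (fun x hx => (⟨x, hx⟩ : Fin m)) hlm)
        (by simp; omega) ⟨j, by omega⟩
      simpa [List.map_pmap] using h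
  have hP : ∀ s : Fin k → ℕ, StrictMono s → (P (g ∘ s) ↔ predict U Q k []) := by
    intro s hs
    rw [← key (List.ofFn s) 0 ?_ (by simp)]
    · refine iff_of_eq (congrArg P ?_)
      funext i
      simp
    · rw [List.pairwise_ofFn]
      exact fun i j hij => hs hij
  exact ⟨g, hmono, fun s t hs ht => (hP s hs).trans (hP t ht).symm⟩

/-- Ramsey's theorem for finitely many colourings at once, of tuples of possibly different
lengths. -/
theorem exists_homogeneous_subseq_finset {ι : Type*} (D : Finset ι) (k : ι → ℕ)
    (P : ∀ i, (Fin (k i) → ℕ) → Prop) :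
    ∃ g : ℕ → ℕ, StrictMono g ∧ ∀ i ∈ D,
      ∀ s t : Fin (k i) → ℕ, StrictMono s → StrictMono t → (P i (g ∘ s) ↔ P i (g ∘ t)) := by
  classical
  induction D using Finset.induction_on with
  | empty => exact ⟨id, strictMono_id, by simp⟩
  | insert i D _ ih =>
    obtain ⟨g, hg, hD⟩ := ih
    obtain ⟨h, hh, hi⟩ := exists_homogeneous_subseq (k i) fun s => P i (g ∘ s)
    refine ⟨g ∘ h, hg.comp hh, fun j hj s t hs ht => ?_⟩
    rcases Finset.mem_insert.1 hj with rfl | hj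
    · exact hi s t hs ht
    · exact hD j hj (h ∘ s) (h ∘ t) (hh.comp hs) (hh.comp ht)

end Ramsey

section IndiscerniblePairs
open FirstOrder.Language Filter

variable {L : FirstOrder.Language.{u, v}} {M : Type w} [L.Structure M] {κ : Cardinal.{w}}

/-! ### Extracting indiscernible sequences -/

/-- Every sequence `c` has an indiscernible sequence over any countable order `J` modelled on it: a
formula is inherited as soon as it holds of all reindexings of `c` by maps `f : J → ℕ` that
respect strict inequalities below the elements of some finite `F ⊆ J`. No map need be strictly monotone
on all of `J`, which may not embed in `ℕ`. -/
theorem exists_indiscernible [Nonempty M] (hM : IsSaturated L M κ) (hκ : ℵ₀ < κ)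
    {γ J : Type*} [Countable γ] [Countable J] [LinearOrder J] (c : ℕ → γ → M) :
    ∃ c' : J → γ → M, Indiscernible L ∅ c' ∧
      ∀ (ψ : L.Formula (J × γ)) (F : Finset J),
        (∀ f : J → ℕ, (∀ i, ∀ j ∈ F, i < j → f i < f j) →
          ψ.Realize fun q => c (f q.1) q.2) → ψ.Realize fun q => c' q.1 q.2 := by
  classical
  choose h hmono hh using fun D : Finset (Σ k, L.Formula (Fin k × γ)) =>
    exists_homogeneous_subseq_finset D Sigma.fst
      fun i s => i.2.Realize fun q => c (s q.1) q.2
  -- `r F` is monotone, and increases strictly at every element of `F`.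
  let r : Finset J → J → ℕ := fun F j => (F.filter (· ≤ j)).card
  have hr : ∀ F : Finset J, ∀ i, ∀ j ∈ F, i < j → r F i < r F j := by
    intro F i j hj hij
    refine Finset.card_lt_card ⟨fun x hx => ?_, fun hs => ?_⟩
    · rw [Finset.mem_filter] at hx ⊢
      exact ⟨hx.1, hx.2.trans hij.le⟩
    · exact (Finset.mem_filter.1 (hs (Finset.mem_filter.2 ⟨hj, le_rfl⟩))).2.not_gt hij
  let U : Ultrafilter (Finset (Σ k, L.Formula (Fin k × γ)) × Finset J) := Ultrafilter.of atTop
  have hU : ∀ D F, ∀ᶠ x : Finset (Σ k, L.Formula (Fin k × γ)) × Finset J in U,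
      D ≤ x.1 ∧ F ≤ x.2 := fun D F => Ultrafilter.of_le _ (eventually_ge_atTop (D, F))
  obtain ⟨g, hg⟩ := hM.exists_limit hκ U
    fun (x : Finset (Σ k, L.Formula (Fin k × γ)) × Finset J) (q : J × γ) => c (h x.1 (r x.2 q.1)) q.2
  refine ⟨fun j k => g (j, k), ?_, fun ψ F hψ => ?_⟩
  · refine .of_formula (V := Empty) Empty.elim (by simp) fun n χ s t hs ht => ?_
    let ψ : L.Formula (Fin n × γ) := Formula.relabel (Sum.elim Empty.elim id) χ
    have key : ∀ s : Fin n → J, χ.Realize (Sum.elim Empty.elim fun q => g (s q.1, q.2)) ↔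
        ∀ᶠ x : Finset (Σ k, L.Formula (Fin k × γ)) × Finset J in U,
          ψ.Realize fun q => c (h x.1 (r x.2 (s q.1))) q.2 := by
      intro s
      have := hg (ψ.relabel fun q => (s q.1, q.2))
      simp only [Formula.realize_relabel] at this
      refine Iff.trans ?_ this
      refine (realize_relabel_of_eq fun i => ?_).symm
      rcases i with i | i
      · exact i.elim
      · rfl
    rw [key, key]
    refine eventually_congr ((hU {⟨n, ψ⟩} (Finset.univ.image s ∪ Finset.univ.image t)).mono ?_)
    rintro ⟨D, F⟩ ⟨hD, hF⟩
    refine hh D ⟨n, ψ⟩ (hD (Finset.mem_singleton_self _)) (fun i => r F (s i))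
      (fun i => r F (t i)) (fun i j hij => hr F _ _ (hF ?_) (hs hij))
      (fun i j hij => hr F _ _ (hF ?_) (ht hij))
    · exact Finset.mem_union_left _ (Finset.mem_image_of_mem _ (Finset.mem_univ _))
    · exact Finset.mem_union_right _ (Finset.mem_image_of_mem _ (Finset.mem_univ _))
  · refine (hg ψ).2 ((hU ∅ F).mono fun x hx => ?_)
    exact hψ (fun j => h x.1 (r x.2 j)) fun i j hj hij => hmono _ (hr _ _ _ (hx.2 hj) hij)

/-! ### Pairs of sequences from an `SOP₁` tree -/

theorem restrict_getD_of_prefix {l l' : List Bool} (h : l <+: l') :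
    restrict (fun n => l'.getD n false) l.length = l := by
  obtain ⟨t, rfl⟩ := h
  refine List.ext_getElem (by simp [restrict]) fun i h₁ h₂ => ?_
  simp [restrict, List.getElem?_append_left h₂, List.getElem?_eq_getElem h₂]

variable {α β : Type*}

/-- In an `SOP₁` tree there is a sequence of pairs `(dᵢ, eᵢ) = (c i (false, ·), c i (true, ·))` with
`{φ(x; dᵢ)}` consistent, `{φ(x; eᵢ)}` `2`-inconsistent, and such that `dᵢ` and `eᵢ` cannot be told apart
over the earlier pairs by any formula of a given finite set `D`. -/
theorem exists_pairs_finset {φ : L.Formula (α ⊕ β)} (hφ : HasSOP1 M φ)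
    (D : Finset (Σ i : ℕ, L.Formula ((Fin i × (Bool × β)) ⊕ β))) :
    ∃ c : ℕ → Bool × β → M,
      Consistent φ (fun i k => c i (false, k)) ∧
      (∀ i j, i < j → ¬ ∃ x : α → M, φ.Realize (Sum.elim x fun k => c i (true, k)) ∧
        φ.Realize (Sum.elim x fun k => c j (true, k))) ∧
      ∀ i (χ : L.Formula ((Fin i × (Bool × β)) ⊕ β)), ⟨i, χ⟩ ∈ D →
        (χ.Realize (Sum.elim (fun q => c q.1 q.2) fun k => c i (false, k)) ↔
          χ.Realize (Sum.elim (fun q => c q.1 q.2) fun k => c i (true, k))) := by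
  obtain ⟨a, hcons, hinc⟩ := hφ
  -- A pair of nodes `(η, ζ)` encodes `d = a ζ` and `e = a (η ⌢ 1)`; it will satisfy `η ⌢ 0 ⊴ ζ`.
  let C : List Bool × List Bool → Bool × β → M := fun y q =>
    if q.1 then a (y.1 ++ [true]) q.2 else a y.2 q.2
  obtain ⟨f, hf⟩ := exists_seq_of_forall_exists
    (fun i (g : Fin i → List Bool × List Bool) x =>
      x.1 ++ [false] <+: x.2 ∧ (∀ j : Fin i, (j : ℕ) + 1 = i → (g j).2 <+: x.1) ∧
      ∀ χ : L.Formula ((Fin i × (Bool × β)) ⊕ β), ⟨i, χ⟩ ∈ D →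
        (χ.Realize (Sum.elim (fun q => C (g q.1) q.2) (a x.2)) ↔
          χ.Realize (Sum.elim (fun q => C (g q.1) q.2) (a (x.1 ++ [true]))))) (by
    intro i g
    obtain ⟨ζ, hζ⟩ : ∃ ζ : List Bool, ∀ j : Fin i, (j : ℕ) + 1 = i → (g j).2 <+: ζ := by
      cases i with
      | zero => exact ⟨[], fun j => j.elim0⟩
      | succ i =>
        refine ⟨(g (Fin.last i)).2, fun j hj => ?_⟩
        obtain rfl : j = Fin.last i := Fin.ext (by simpa using hj)
        exact List.prefix_rfl
    let E := {χ : L.Formula ((Fin i × (Bool × β)) ⊕ β) //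
      (⟨i, χ⟩ : Σ i : ℕ, L.Formula ((Fin i × (Bool × β)) ⊕ β)) ∈ D}
    have : Finite E := Finite.of_injective (fun χ : E => (⟨_, χ.2⟩ : D)) fun χ χ' h =>
      Subtype.ext (by simpa using h)
    -- By pigeonhole two of the nodes `ζ ⌢ 0ᵏ ⌢ 1` have the same truth values for the formulas of `D`
    -- over the earlier pairs; for `k < l`, the node of `l` lies above `ζ ⌢ 0ᵏ ⌢ 0`.
    let F : ℕ → E → Prop := fun k χ => χ.1.Realize (Sum.elim (fun q => C (g q.1) q.2)
      (a (ζ ++ List.replicate k false ++ [true])))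
    obtain ⟨k, l, hkl, hF⟩ : ∃ k l, k < l ∧ F k = F l := by
      obtain ⟨k, l, hne, hF⟩ := Finite.exists_ne_map_eq_of_infinite F
      rcases hne.lt_or_gt with h | h
      · exact ⟨k, l, h, hF⟩
      · exact ⟨l, k, h, hF.symm⟩
    refine ⟨(ζ ++ List.replicate k false, ζ ++ List.replicate l false ++ [true]), ?_,
      fun j hj => (hζ j hj).trans (List.prefix_append _ _), fun χ hχ => ?_⟩
    · obtain ⟨d, rfl⟩ := Nat.exists_eq_add_of_lt hkl
      rw [Nat.add_assoc, List.replicate_add, Nat.add_comm d, List.replicate_add]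
      exact ⟨List.replicate d false ++ [true], by simp⟩
    · exact (iff_of_eq (congrFun hF ⟨χ, hχ⟩)).symm)
  have hstep : ∀ i, (f i).1 <+: (f i).2 := fun i => (List.prefix_append _ _).trans (hf i).1
  have hlt : ∀ i j, i < j → (f i).2 <+: (f j).1 := by
    intro i j hij
    induction j, hij using Nat.le_induction with
    | base => exact (hf (i + 1)).2.1 ⟨i, by omega⟩ rfl
    | succ j _ ih =>
      exact (ih.trans (hstep j)).trans ((hf (j + 1)).2.1 ⟨j, by omega⟩ rfl)
  have hle : ∀ i j, i ≤ j → (f i).2 <+: (f j).2 := by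
    intro i j hij
    rcases hij.eq_or_lt with rfl | h
    · exact List.prefix_rfl
    · exact (hlt i j h).trans (hstep j)
  refine ⟨fun i => C (f i), fun s => ?_, fun i j hij => ?_, fun i χ hχ => ?_⟩
  · obtain ⟨x, hx⟩ := hcons (fun n => (f (s.sup id)).2.getD n false)
      (s.image fun i => (f i).2.length)
    refine ⟨x, fun i hi => ?_⟩
    have := hx _ (Finset.mem_image_of_mem _ hi)
    have hp := restrict_getD_of_prefix (hle i (s.sup id) (Finset.le_sup (f := id) hi))
    simp only [hp] at this
    exact this
  · rintro ⟨x, hi, hj⟩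
    refine hinc (f i).1 ((f j).1 ++ [true]) ?_ ⟨x, hj, hi⟩
    exact (hf i).1.trans ((hlt i j hij).trans (List.prefix_append _ _))
  · exact (hf i).2.2 χ hχ

/-- The finite set of formulas in `exists_pairs_finset` is replaced by all formulas, so that `dᵢ` and
`eᵢ` have the same type over the earlier pairs. -/
theorem exists_pairs [Nonempty M] (hM : IsSaturated L M κ) (hκ : ℵ₀ < κ) [Finite α] [Countable β]
    {φ : L.Formula (α ⊕ β)} (hφ : HasSOP1 M φ) :
    ∃ c : ℕ → Bool × β → M,
      Consistent φ (fun i k => c i (false, k)) ∧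
      (∀ i j, i < j → ¬ ∃ x : α → M, φ.Realize (Sum.elim x fun k => c i (true, k)) ∧
        φ.Realize (Sum.elim x fun k => c j (true, k))) ∧
      ∀ i (χ : L.Formula ((Fin i × (Bool × β)) ⊕ β)),
        (χ.Realize (Sum.elim (fun q => c q.1 q.2) fun k => c i (false, k)) ↔
          χ.Realize (Sum.elim (fun q => c q.1 q.2) fun k => c i (true, k))) := by
  choose C hcons hinc hC using fun D => exists_pairs_finset (M := M) hφ D
  let U : Ultrafilter (Finset (Σ i : ℕ, L.Formula ((Fin i × (Bool × β)) ⊕ β))) :=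
    Ultrafilter.of atTop
  obtain ⟨g, hg⟩ := hM.exists_limit hκ U fun D (q : ℕ × (Bool × β)) => C D q.1 q.2
  refine ⟨fun i q => g (i, q), fun s => ?_, fun i j hij => ?_, fun i χ => ?_⟩
  · obtain ⟨χ, hχ⟩ := exists_formula_consistent (M := M) φ
      fun (i : s) k => ((i, (false, k)) : ℕ × (Bool × β))
    obtain ⟨x, hx⟩ := (hχ _).1 ((hg χ).2 (Eventually.of_forall fun D => (hχ _).2 (by
      obtain ⟨x, hx⟩ := hcons D s
      exact ⟨x, fun i => hx i i.2⟩)))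
    exact ⟨x, fun i hi => hx ⟨i, hi⟩⟩
  · obtain ⟨χ, hχ⟩ := exists_formula_consistent (M := M) φ
      fun (b : Bool) k => ((bif b then i else j, (true, k)) : ℕ × (Bool × β))
    rintro ⟨x, hi, hj⟩
    obtain ⟨D, hD⟩ := ((hg χ).1 ((hχ g).2 ⟨x, fun b => by cases b <;> assumption⟩)).exists
    obtain ⟨y, hy⟩ := (hχ _).1 hD
    exact hinc D i j hij ⟨y, hy true, hy false⟩
  · have key : ∀ b : Bool,
        χ.Realize (Sum.elim (fun q => g (q.1, q.2)) fun k => g (i, (b, k))) ↔ ∀ᶠ D in U,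
          χ.Realize (Sum.elim (fun q => C D q.1 q.2) fun k => C D i (b, k)) := by
      intro b
      have h : ∀ y : ℕ × (Bool × β) → M, (Formula.relabel
          (Sum.elim (fun q => (q.1.1, q.2)) fun k => (i, (b, k))) χ).Realize y ↔
          χ.Realize (Sum.elim (fun q => y (q.1, q.2)) fun k => y (i, (b, k))) := fun y =>
        realize_relabel_of_eq fun q => by rcases q with q | q <;> rfl
      rw [← h, hg]
      exact eventually_congr (Eventually.of_forall fun D => h _)
    rw [key, key]
    have hU : ∀ᶠ D : Finset (Σ i : ℕ, L.Formula ((Fin i × (Bool × β)) ⊕ β)) in U,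
        {⟨i, χ⟩} ≤ D := Ultrafilter.of_le _ (eventually_ge_atTop _)
    exact eventually_congr (hU.mono fun D hD => hC D i χ (hD (Finset.mem_singleton_self _)))

/-- The sequence of pairs of `exists_pairs` may be taken indiscernible and indexed by any countable
linear order. -/
theorem exists_indiscernible_pairs [Nonempty M] (hM : IsSaturated L M κ) (hκ : ℵ₀ < κ) [Finite α]
    [Countable β] {φ : L.Formula (α ⊕ β)} (hφ : HasSOP1 M φ) (J : Type*) [Countable J]
    [LinearOrder J] :
    ∃ c : J → Bool × β → M, Indiscernible L ∅ c ∧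
      Consistent φ (fun i k => c i (false, k)) ∧
      (∀ i j, i < j → ¬ ∃ x : α → M, φ.Realize (Sum.elim x fun k => c i (true, k)) ∧
        φ.Realize (Sum.elim x fun k => c j (true, k))) ∧
      ∀ j (χ : L.Formula ({q : J × (Bool × β) // q.1 < j} ⊕ β)),
        (χ.Realize (Sum.elim (fun q => c q.1.1 q.1.2) fun k => c j (false, k)) ↔
          χ.Realize (Sum.elim (fun q => c q.1.1 q.1.2) fun k => c j (true, k))) := by
  obtain ⟨c₀, hcons, hinc, htp⟩ := exists_pairs hM hκ hφ
  obtain ⟨c, hc, hg⟩ := exists_indiscernible (J := J) hM hκ c₀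
  refine ⟨c, hc, fun s => ?_, fun i j hij => ?_, fun j χ => ?_⟩
  · obtain ⟨χ, hχ⟩ := exists_formula_consistent (M := M) φ
      fun (i : s) k => ((i, (false, k)) : J × (Bool × β))
    obtain ⟨x, hx⟩ := (hχ _).1 (hg χ ∅ fun f _ => (hχ _).2 (by
      classical
      obtain ⟨x, hx⟩ := hcons (s.image f)
      exact ⟨x, fun i => hx _ (Finset.mem_image_of_mem _ i.2)⟩))
    exact ⟨x, fun i hi => hx ⟨i, hi⟩⟩
  · obtain ⟨χ, hχ⟩ := exists_formula_consistent (M := M) φ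
      fun (b : Bool) k => ((bif b then i else j, (true, k)) : J × (Bool × β))
    rintro ⟨x, hi, hj⟩
    refine Formula.realize_not.1 (hg χ.not {j} fun f hf => Formula.realize_not.2 fun h => ?_)
      ((hχ _).2 ⟨x, fun b => by cases b <;> assumption⟩)
    obtain ⟨y, hy⟩ := (hχ _).1 h
    exact hinc _ _ (hf i j (Finset.mem_singleton_self _) hij) ⟨y, hy true, hy false⟩
  · let θ : Bool → L.Formula (J × (Bool × β)) := fun b =>
      Formula.relabel (Sum.elim (fun q => q.1) fun k => (j, (b, k))) χ
    have key : ∀ (b : Bool) (y : J → Bool × β → M), (θ b).Realize (fun q => y q.1 q.2) ↔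
        χ.Realize (Sum.elim (fun q => y q.1.1 q.1.2) fun k => y j (b, k)) := by
      exact fun b y => realize_relabel_of_eq fun q => by rcases q with q | q <;> rfl
    rw [← key, ← key, ← Formula.realize_iff]
    refine hg _ {j} fun f hf => ?_
    rw [Formula.realize_iff, key _ fun j => c₀ (f j), key _ fun j => c₀ (f j)]
    refine Iff.trans ?_ ((htp (f j) (Formula.relabel (Sum.map (fun q => ((⟨f q.1.1,
      hf _ _ (Finset.mem_singleton_self _) q.2⟩ : Fin (f j)), q.1.2)) id) χ)).trans ?_)
    · exact (realize_relabel_of_eq fun q => by rcases q with q | q <;> rfl).symm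
    · exact realize_relabel_of_eq fun q => by rcases q with q | q <;> rfl

end IndiscerniblePairs

section SkewTreeOfSOP1
open FirstOrder.Language

/-! ### The skew tree property from `SOP₁` -/

variable {L : FirstOrder.Language.{u, v}} {M : Type w} [L.Structure M] {κ : Cardinal.{w}}

theorem strictMono_lex_elim {A B J : Type*} [LinearOrder A] [LinearOrder B] [LinearOrder J]
    {f : A → J} {g : B → J} (hf : StrictMono f) (hg : StrictMono g) (hfg : ∀ a b, f a < g b) :
    StrictMono (fun x : A ⊕ₗ B => Sum.elim f g (ofLex x)) := by
  intro x y hxy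
  induction x using Lex.rec with | _ x
  induction y using Lex.rec with | _ y
  rcases x with x | x <;> rcases y with y | y
  · exact hf (Sum.Lex.inl_lt_inl_iff.1 hxy)
  · exact hfg x y
  · exact absurd hxy Sum.Lex.not_inr_lt_inl
  · exact hg (Sum.Lex.inr_lt_inr_iff.1 hxy)

/-- Index the pairs `(dᵢ, eᵢ)` by `ω + ω* + ω`, with points `X i`, `Y i`, `Z i`. The sequence `a`
consists of the `d` over the two copies of `ω`, and `b` of `d (Z 0)` followed by the `e` over `ω*`, read
backwards. -/
theorem HasSOP1.hasSkewTreeProperty [Nonempty M] (hM : IsSaturated L M κ) (hκ : ℵ₀ < κ)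
    {α β : Type*} [Finite α] [Countable β] {φ : L.Formula (α ⊕ β)} (hφ : HasSOP1 M φ) :
    HasSkewTreeProperty M φ := by
  have : Countable (ℕ ⊕ₗ (ℕᵒᵈ ⊕ₗ ℕ)) := inferInstanceAs (Countable (ℕ ⊕ (ℕ ⊕ ℕ)))
  obtain ⟨c, hc, hcons, hinc, htp⟩ := exists_indiscernible_pairs hM hκ hφ (ℕ ⊕ₗ (ℕᵒᵈ ⊕ₗ ℕ))
  let X : ℕ → ℕ ⊕ₗ (ℕᵒᵈ ⊕ₗ ℕ) := fun i => Sum.inlₗ i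
  let Y : ℕ → ℕ ⊕ₗ (ℕᵒᵈ ⊕ₗ ℕ) := fun i => Sum.inrₗ (Sum.inlₗ (OrderDual.toDual i))
  let Z : ℕ → ℕ ⊕ₗ (ℕᵒᵈ ⊕ₗ ℕ) := fun i => Sum.inrₗ (Sum.inrₗ i)
  have hX : StrictMono X := fun i j h => Sum.Lex.inl_lt_inl_iff.2 h
  have hY : ∀ i j, i < j → Y j < Y i := fun i j h =>
    Sum.Lex.inr_lt_inr_iff.2 (Sum.Lex.inl_lt_inl_iff.2 h)
  have hZ : StrictMono Z := fun i j h =>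
    Sum.Lex.inr_lt_inr_iff.2 (Sum.Lex.inr_lt_inr_iff.2 h)
  have hXY : ∀ i j, X i < Y j := fun i j => Sum.Lex.inl_lt_inr _ _
  have hXZ : ∀ i j, X i < Z j := fun i j => Sum.Lex.inl_lt_inr _ _
  have hYZ : ∀ i j, Y i < Z j := fun i j =>
    Sum.Lex.inr_lt_inr_iff.2 (Sum.Lex.inl_lt_inr _ _)
  clear_value X Y Z
  -- `h` lists the indices of `b` in decreasing order, with `Z 0` as the index of `b 0`.
  let h : ℕ → ℕ ⊕ₗ (ℕᵒᵈ ⊕ₗ ℕ) := fun i => Nat.casesOn i (Z 0) Y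
  have hh : ∀ i j, i < j → h j < h i := by
    rintro (_ | i) (_ | j) hij
    · exact absurd hij (lt_irrefl _)
    · exact hYZ _ _
    · exact absurd hij (Nat.not_lt_zero _)
    · exact hY _ _ (Nat.lt_of_succ_lt_succ hij)
  have hXh : ∀ i j, X i < h j := by
    rintro i (_ | j)
    · exact hXZ _ _
    · exact hXY _ _
  let b : ℕ → β → M := fun i k => Nat.casesOn i (c (Z 0) (false, k)) fun i => c (Y i) (true, k)
  have hb : Indiscernible L (coords fun i k => c (X i) (false, k)) b := by
    refine .of_formula (fun q : ℕ × β => c (X q.1) (false, q.2)) ?_ fun n χ s t hs ht => ?_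
    · rintro _ ⟨i, j, rfl⟩
      exact ⟨(i, j), rfl⟩
    -- Since `d (Z 0)` and `e (Z 0)` have the same type over everything below `Z 0`, the term `b 0` may
    -- be replaced by `e (Z 0)`; then `b` becomes a decreasing subsequence of `e`.
    · have h₁ : ∀ s : Fin n → ℕ,
          χ.Realize (Sum.elim (fun q => c (X q.1) (false, q.2)) fun q => b (s q.1) q.2) ↔
          χ.Realize (Sum.elim (fun q => c (X q.1) (false, q.2))
            fun q => c (h (s q.1)) (true, q.2)) := by
        intro s
        have := htp (Z 0) (Formula.relabel (Sum.elim
          (fun q => Sum.inl ⟨(X q.1, (false, q.2)), hXZ _ _⟩)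
          fun q => Nat.casesOn (s q.1) (Sum.inr q.2) fun i =>
            Sum.inl ⟨(Y i, (true, q.2)), hYZ _ _⟩) χ)
        refine Iff.trans ?_ (this.trans ?_)
        · refine (realize_relabel_of_eq fun q => ?_).symm
          rcases q with q | ⟨i, k⟩
          · rfl
          · simp only [Sum.elim_inr, b]
            cases s i <;> rfl
        · refine realize_relabel_of_eq fun q => ?_
          rcases q with q | ⟨i, k⟩
          · rfl
          · simp only [Sum.elim_inr, h]
            cases s i <;> rfl
      have h₂ : ∀ s : Fin n → ℕ, StrictMono s → StrictMono
          fun x : ℕ ⊕ₗ (Fin n)ᵒᵈ => Sum.elim X (fun i => h (s (OrderDual.ofDual i))) (ofLex x) :=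
        fun s hs => strictMono_lex_elim hX (fun i j hij => hh _ _ (hs hij)) fun _ _ => hXh _ _
      have h₃ := hc.realize_iff_of_strictMono (Formula.relabel (Sum.elim
        (fun q => (Sum.inlₗ q.1, (false, q.2)))
        fun q => (Sum.inrₗ (OrderDual.toDual q.1), (true, q.2))) χ) (h₂ s hs) (h₂ t ht)
      rw [h₁, h₁]
      refine Iff.trans ?_ (h₃.trans ?_)
      · exact (realize_relabel_of_eq fun q => by rcases q with q | q <;> rfl).symm
      · exact realize_relabel_of_eq fun q => by rcases q with q | q <;> rfl
  let f : ℕ ⊕ₗ ℕ → ℕ ⊕ₗ (ℕᵒᵈ ⊕ₗ ℕ) := fun x => Sum.elim X Z (ofLex x)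
  have hf : StrictMono f := strictMono_lex_elim hX hZ hXZ
  refine ⟨fun i k => c (f i) (false, k), b, ?_, hb.mono (Set.empty_subset _), ?_, ?_, hb, ?_, rfl⟩
  · refine .of_formula (V := Empty) Empty.elim (by simp) fun n χ s t hs ht => ?_
    refine Iff.trans ?_ ((hc.realize_iff_of_strictMono (Formula.relabel
      (Sum.elim Empty.elim fun q => (q.1, (false, q.2))) χ) (hf.comp hs) (hf.comp ht)).trans ?_)
    · exact (realize_relabel_of_eq fun q => by rcases q with ⟨⟨⟩⟩ | q; rfl).symm
    · exact realize_relabel_of_eq fun q => by rcases q with ⟨⟨⟩⟩ | q; rfl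
  · intro s
    classical
    obtain ⟨x, hx⟩ := hcons (s.image f)
    exact ⟨x, fun i hi => hx _ (Finset.mem_image_of_mem _ hi)⟩
  · intro hcon
    obtain ⟨x, hx⟩ := hcon {1, 2}
    exact hinc _ _ (hY 0 1 one_pos) ⟨x, hx 2 (by simp), hx 1 (by simp)⟩
  · refine .of_formula (Sum.elim (fun q : ℕ × β => c (X q.1) (false, q.2))
      fun q : ℕ × β => c (Y q.1) (true, q.2)) ?_ fun n χ s t hs ht => ?_
    · rintro _ (⟨i, j, rfl⟩ | ⟨i, j, rfl⟩)
      · exact ⟨Sum.inl (i, j), rfl⟩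
      · exact ⟨Sum.inr (i, j), rfl⟩
    · have h₁ : StrictMono fun x : ℕ ⊕ₗ ℕᵒᵈ =>
          Sum.elim X (fun i => Y (OrderDual.ofDual i)) (ofLex x) :=
        strictMono_lex_elim hX (fun i j hij => hY _ _ hij) fun _ _ => hXY _ _
      have h₂ : ∀ x : ℕ ⊕ₗ ℕᵒᵈ, ∀ i,
          Sum.elim X (fun i => Y (OrderDual.ofDual i)) (ofLex x) < Z i := by
        intro x i
        induction x using Lex.rec with | _ x
        rcases x with x | x
        · exact hXZ _ _
        · exact hYZ _ _
      refine Iff.trans ?_ ((hc.realize_iff_of_strictMono (Formula.relabel (Sum.elim (Sum.elim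
        (fun q => (Sum.inlₗ (Sum.inlₗ q.1), (false, q.2)))
        fun q => (Sum.inlₗ (Sum.inrₗ (OrderDual.toDual q.1)), (true, q.2)))
        fun q => (Sum.inrₗ q.1, (false, q.2))) χ)
        (strictMono_lex_elim h₁ (hZ.comp hs) fun _ _ => h₂ _ _)
        (strictMono_lex_elim h₁ (hZ.comp ht) fun _ _ => h₂ _ _)).trans ?_)
      · exact (realize_relabel_of_eq fun q => by rcases q with (q | q) | q <;> rfl).symm
      · exact realize_relabel_of_eq fun q => by rcases q with (q | q) | q <;> rfl

end SkewTreeOfSOP1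

/-! ### The tree property from the skew tree property -/

section TreeOfSkewTree
open FirstOrder.Language

variable {L : FirstOrder.Language.{u, v}} {M : Type w} [L.Structure M] {κ : Cardinal.{w}}

theorem realize_equiv_comp {α β : Type*} (φ : L.Formula (α ⊕ β)) (σ : M ≃[L] M) (x : α → M)
    (y : β → M) : φ.Realize (Sum.elim (σ ∘ x) (σ ∘ y)) ↔ φ.Realize (Sum.elim x y) := by
  rw [← Sum.comp_elim]
  exact StrongHomClass.realize_formula σ φ

theorem KInconsistent.mono {α β I : Type*} {φ : L.Formula (α ⊕ β)} {a : I → β → M} {k l : ℕ}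
    (h : KInconsistent k φ a) (hkl : k ≤ l) : KInconsistent l φ a := by
  intro s hs ⟨x, hx⟩
  obtain ⟨t, ht, htk⟩ := Finset.exists_subset_card_eq (hkl.trans hs.ge)
  exact h t htk ⟨x, fun i hi => hx i (ht hi)⟩

theorem KInconsistent.equiv_comp {α β I : Type*} {φ : L.Formula (α ⊕ β)} {a : I → β → M} {k : ℕ}
    (h : KInconsistent k φ a) (σ : M ≃[L] M) : KInconsistent k φ fun i => σ ∘ a i := by
  rintro s hs ⟨x, hx⟩
  refine h s hs ⟨σ.symm ∘ x, fun i hi => (realize_equiv_comp φ σ _ _).1 ?_⟩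
  have : σ ∘ σ.symm ∘ x = x := funext fun _ => σ.apply_symm_apply _
  rw [this]
  exact hx i hi

/-- By compactness an inconsistent set of instances along a sequence has a finite inconsistent part;
indiscernibility turns its size `k` into `k`-inconsistency. -/
theorem Indiscernible.exists_kInconsistent {α β I : Type*} [Finite α] [LinearOrder I]
    {φ : L.Formula (α ⊕ β)} {b : I → β → M} (hb : Indiscernible L ∅ b) (h : ¬ Consistent φ b) :
    ∃ k, KInconsistent k φ b := by
  unfold Consistent at h
  push Not at h
  obtain ⟨s, hs⟩ := h
  refine ⟨s.card, fun t ht ⟨x, hx⟩ => ?_⟩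
  obtain ⟨χ, hχ⟩ := exists_formula_consistent (M := M) φ
    fun (i : Fin s.card) k => ((i, k) : Fin s.card × β)
  have h := hb.realize_iff_of_strictMono χ (s.orderEmbOfFin rfl).strictMono
    (t.orderEmbOfFin ht).strictMono
  obtain ⟨y, hy⟩ := (hχ _).1 (h.2 ((hχ _).2 ⟨x, fun i => hx _ (t.orderEmbOfFin_mem ht i)⟩))
  obtain ⟨i, hi, hn⟩ := hs y
  obtain ⟨j, rfl⟩ : i ∈ Set.range (s.orderEmbOfFin rfl) := by
    rwa [Finset.range_orderEmbOfFin]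
  exact hn (hy j)

/-- The composite `τ d l₀ ∘ τ (d + 1) l₁ ∘ ⋯` of the automorphisms chosen along the list `l`. -/
def branchEquiv (τ : ℕ → ℕ → M ≃[L] M) : ℕ → List ℕ → (M ≃[L] M)
  | _, [] => .refl L M
  | d, j :: l => (τ d j).comp (branchEquiv τ (d + 1) l)

/-- Recursion from the front of the list makes the last entry act first, so the automorphism of a
child node is that of its parent precomposed with one `τ`. -/
theorem branchEquiv_append_singleton (τ : ℕ → ℕ → M ≃[L] M) (d : ℕ) (l : List ℕ) (j : ℕ) (x : M) :
    branchEquiv τ d (l ++ [j]) x = branchEquiv τ d l (τ (d + l.length) j x) := by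
  induction l generalizing d with
  | nil => rfl
  | cons i l ih =>
    have : d + (i :: l).length = d + 1 + l.length := by simp; omega
    rw [this]
    exact congrArg (τ d i) (ih (d + 1))

/-- A consistent sequence `a`, together with automorphisms `τ n j` fixing `a i` for `i < n` and moving
`a n` to `k`-inconsistent places as `j` varies, unfolds to a tree: the node `l` carries the image of
`a l.length` under the automorphism of the branch `l`. Each branch is, up to any finite height, the image
of an initial segment of `a` under one automorphism. -/
theorem hasTreeProperty_of_equivs {α β : Type*} {φ : L.Formula (α ⊕ β)} (a : ℕ → β → M)
    (ha : Consistent φ a) (τ : ℕ → ℕ → M ≃[L] M)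
    (hfix : ∀ n j, ∀ i < n, ∀ k, τ n j (a i k) = a i k) {k : ℕ}
    (hinc : ∀ n, KInconsistent k φ fun j => τ n j ∘ a n) :
    HasTreeProperty M φ := by
  -- Raising `k` to `k + 2` secures the bound `2 ≤ k` of the definition.
  refine ⟨k + 2, by omega, fun l => branchEquiv τ 1 l ∘ a l.length, fun η s => ?_, fun l => ?_⟩
  · have key : ∀ N, ∀ n ≤ N, ∀ k, branchEquiv τ 1 (restrict η N) (a n k) =
        branchEquiv τ 1 (restrict η n) (a n k) := by
      intro N
      induction N with
      | zero => intro n hn k; rw [Nat.le_zero.1 hn]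
      | succ N ih =>
        intro n hn k
        rcases hn.lt_or_eq with hn | rfl
        · have : restrict η (N + 1) = restrict η N ++ [η N] := by
            rw [restrict, List.ofFn_succ_last]
            rfl
          rw [this, branchEquiv_append_singleton, hfix _ _ n, ih n (by omega)]
          simp [restrict]
          omega
        · rfl
    obtain ⟨x, hx⟩ := ha s
    refine ⟨branchEquiv τ 1 (restrict η (s.sup id)) ∘ x, fun n hn => ?_⟩
    have h := (realize_equiv_comp φ (branchEquiv τ 1 (restrict η (s.sup id))) _ _).2 (hx n hn)
    have hl : (restrict η n).length = n := by simp [restrict]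
    have hc : branchEquiv τ 1 (restrict η n) ∘ a (restrict η n).length =
        branchEquiv τ 1 (restrict η (s.sup id)) ∘ a n := by
      rw [hl]
      exact funext fun k => (key _ n (Finset.le_sup (f := id) hn) k).symm
    rw [← hc] at h
    exact h
  · have h := ((hinc (l.length + 1)).mono (show k ≤ k + 2 by omega)).equiv_comp (branchEquiv τ 1 l)
    convert h using 2 with j
    funext i
    simp [branchEquiv_append_singleton, Nat.add_comm 1]

/-- With `a`, `b` as in the skew tree property, an automorphism over `a_{<n}` moves `a_ω = b₀` to
`a_n`, and thereby moves `b` to a `k`-inconsistent sequence indiscernible over `a_{<n}` and beginning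
with `a_n`. Conjugating the automorphisms over `a_{<ω}` from `b₀` to `b_j` gives the maps needed in
`hasTreeProperty_of_equivs`. -/
theorem HasSkewTreeProperty.hasTreeProperty (hM : IsHomogeneous L M κ) (hκ : ℵ₀ < κ)
    {α β : Type*} [Finite α] [Countable β] {φ : L.Formula (α ⊕ β)}
    (hφ : HasSkewTreeProperty M φ) : HasTreeProperty M φ := by
  obtain ⟨a, b, ha, hb, hcons, hinc, hab, -, h0⟩ := hφ
  obtain ⟨k, hk⟩ := hb.exists_kInconsistent hinc
  have hτ : ∀ j, ∃ τ : M ≃[L] M, (∀ i k, τ (a (Sum.inlₗ i) k) = a (Sum.inlₗ i) k) ∧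
      ∀ k, τ (b 0 k) = b j k := by
    intro j
    obtain ⟨τ, hτ⟩ := hM.exists_equiv hκ
      (Sum.elim (fun q : ℕ × β => a (Sum.inlₗ q.1) q.2) (b 0))
      (Sum.elim (fun q : ℕ × β => a (Sum.inlₗ q.1) q.2) (b j)) (fun χ => by
        have h := hab.realize_iff (fun q : ℕ × β => a (Sum.inlₗ q.1) q.2)
          (by rintro _ ⟨q, rfl⟩; exact ⟨q.1, q.2, rfl⟩) (n := 1)
          (Formula.relabel (Sum.map id fun k => (0, k)) χ)
          (s := fun _ => 0) (t := fun _ => j) (Subsingleton.strictMono _) (Subsingleton.strictMono _)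
        refine Iff.trans ?_ (h.trans ?_)
        · exact (realize_relabel_of_eq fun q => by rcases q with q | q <;> rfl).symm
        · exact realize_relabel_of_eq fun q => by rcases q with q | q <;> rfl)
    exact ⟨τ, fun i k => hτ (Sum.inl (i, k)), fun k => hτ (Sum.inr k)⟩
  have hρ : ∀ n, ∃ ρ : M ≃[L] M, (∀ i < n, ∀ k, ρ (a (Sum.inlₗ i) k) = a (Sum.inlₗ i) k) ∧
      ∀ k, ρ (b 0 k) = a (Sum.inlₗ n) k := by
    intro n
    let s : Fin n ⊕ₗ Fin 1 → ℕ ⊕ₗ ℕ := fun x =>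
      Sum.elim (fun i : Fin n => Sum.inlₗ (i : ℕ)) (fun _ : Fin 1 => Sum.inrₗ 0) (ofLex x)
    let t : Fin n ⊕ₗ Fin 1 → ℕ ⊕ₗ ℕ := fun x =>
      Sum.elim (fun i : Fin n => Sum.inlₗ (i : ℕ)) (fun _ : Fin 1 => Sum.inlₗ n) (ofLex x)
    have hi : StrictMono fun i : Fin n => (Sum.inlₗ (i : ℕ) : ℕ ⊕ₗ ℕ) := fun i j hij =>
      Sum.Lex.inl_lt_inl_iff.2 hij
    have hs : StrictMono s := strictMono_lex_elim hi (Subsingleton.strictMono _)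
      fun _ _ => Sum.Lex.inl_lt_inr _ _
    have ht : StrictMono t := strictMono_lex_elim hi (Subsingleton.strictMono _)
      fun i _ => Sum.Lex.inl_lt_inl_iff.2 i.2
    have : Countable (Fin n ⊕ₗ Fin 1) := inferInstanceAs (Countable (Fin n ⊕ Fin 1))
    obtain ⟨ρ, hρ⟩ := hM.exists_equiv hκ (fun q : (Fin n ⊕ₗ Fin 1) × β => a (s q.1) q.2)
      (fun q => a (t q.1) q.2) fun ψ => ha.realize_iff_of_strictMono ψ hs ht
    refine ⟨ρ, fun i hi k => hρ (Sum.inlₗ ⟨i, hi⟩, k), fun k => ?_⟩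
    rw [h0]
    exact hρ (Sum.inrₗ 0, k)
  choose τ hτa hτb using hτ
  choose ρ hρa hρb using hρ
  have hρa' : ∀ n, ∀ i < n, ∀ k, (ρ n).symm (a (Sum.inlₗ i) k) = a (Sum.inlₗ i) k := by
    intro n i hi k
    conv_lhs => rw [← hρa n i hi k]
    exact (ρ n).symm_apply_apply _
  have hρb' : ∀ n k, (ρ n).symm (a (Sum.inlₗ n) k) = b 0 k := by
    intro n k
    rw [← hρb n k]
    exact (ρ n).symm_apply_apply _
  refine hasTreeProperty_of_equivs (fun i => a (Sum.inlₗ i)) (fun s => ?_)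
    (fun n j => (ρ n).comp ((τ j).comp (ρ n).symm)) (fun n j i hi k => ?_) (k := k) fun n => ?_
  · classical
    obtain ⟨x, hx⟩ := hcons (s.image Sum.inlₗ)
    exact ⟨x, fun i hi => hx _ (Finset.mem_image_of_mem _ hi)⟩
  · simp only [Equiv.comp_apply]
    rw [hρa' n i hi, hτa, hρa n i hi]
  · convert hk.equiv_comp (ρ n) using 2 with j
    funext i
    simp only [Function.comp_apply, Equiv.comp_apply]
    rw [hρb', hτb]

end TreeOfSkewTree

end SkewTree

theorem mainTheorem10 {L : FirstOrder.Language.{u, v}} (T : L.Theory) (hT : T.IsComplete)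
    (κ : Cardinal.{w}) (M : Type w) [L.Structure M] (hM : SkewTree.IsMonster T κ M)
    {m n : ℕ} (φ : L.Formula (Fin m ⊕ Fin n)) :
    (SkewTree.HasSOP1 M φ → SkewTree.HasSkewTreeProperty M φ) ∧
      (SkewTree.HasSkewTreeProperty M φ → SkewTree.HasTreeProperty M φ) :=
  have := hM.nonempty
  ⟨fun h => h.hasSkewTreeProperty hM.saturated hM.aleph0_lt,
    fun h => h.hasTreeProperty hM.homogeneous hM.aleph0_lt⟩
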